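/- For an integer $L\ge 1$, let $\Omega_L$ be the set of $L$-step prudent paths on $\mathbb{Z}^2$, i.e. nearest-neighbour paths $\pi=(\pi_0,\dots,\pi_L)$ with $\pi_0=(0,0)$ such that for every $0\le i<L$ the sites $\pi_i+k(\pi_{i+1}-\pi_i)$, $k=1,2,3,\dots$, do not belong to $\{\pi_0,\dots,\pi_i\}$. Let $\Omega_L^+\subset\Omega_L$ be the set of 2-sided (north-east) prudent paths, i.e. those $\pi\in\Omega_L$ such that (1) for every $0\le i<L$, none of the sites $\pi_i+k(\pi_{i+1}-\pi_i)$, $k=1,2,3,\dots$, lies in the quadrant $(-\infty,0]^2$; (2) the endpoint $\pi_L$ is the top-right corner of the smallest axis-parallel rectangle containing $\pi$; (3) $\pi_1=(1,0)$. Let $\mathbf{P}^+_{\mathrm{unif},L}$ be the uniform probability measure on $\Omega_L^+$, and for $\pi\in\Omega_L^+$ and $t\in[0,1]$ let $$\tilde\pi^L_t=\frac1L\Big(\pi_{\lfloor tL\rfloor}+(tL-\lfloor tL\rfloor)\big(\pi_{\lfloor tL\rfloor+1}-\pi_{\lfloor tL\rfloor}\big)\Big)$$ be the rescaled, linearly interpolated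 path (at $t=1$ this means $\tilde\pi^L_1=\pi_L/L$). Theorem. There exists a constant $c>0$ such that for every $\varepsilon>0$, $$\lim_{L\to\infty}\mathbf{P}^+_{\mathrm{unif},L}\Big(\sup_{t\in[0,1]}\big|\tilde\pi^L_t-c\,t\,(1,1)\big|\le\varepsilon\Big)=1 .$$ -/

import Mathlib

namespace PrudentWalk

/-- A nearest-neighbour step of `ℤ²`: east, west, north or south. -/
def IsUnitStep (v : ℤ × ℤ) : Prop :=
  v = (1, 0) ∨ v = (-1, 0) ∨ v = (0, 1) ∨ v = (0, -1)

/-- `OnRay π i p`: the site `p` lies in the direction of the `i`-th step of `π`, i.e.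
`p = π_i + k (π_{i+1} - π_i)` for some integer `k ≥ 1`. -/
def OnRay {L : ℕ} (π : Fin (L + 1) → ℤ × ℤ) (i : Fin L) (p : ℤ × ℤ) : Prop :=
  ∃ k : ℕ, 1 ≤ k ∧ p = π i.castSucc + k • (π i.succ - π i.castSucc)

/-- The set `Ω_L` of `L`-step prudent paths: nearest-neighbour paths `(π_0, …, π_L)` in `ℤ²`
starting from the origin that never take a step in the direction of a site already visited. -/
def prudentPaths (L : ℕ) : Set (Fin (L + 1) → ℤ × ℤ) :=
  {π | π 0 = (0, 0) ∧
    (∀ i : Fin L, IsUnitStep (π i.succ - π i.castSucc)) ∧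
    (∀ i : Fin L, ∀ j : Fin (L + 1), j ≤ i.castSucc → ¬ OnRay π i (π j))}

/-- The set `Ω_L⁺` of `L`-step 2-sided (north-east) prudent paths: prudent paths
that take no step in the direction of a site of the quadrant `(-∞, 0]²`,
whose endpoint is the top-right corner of the smallest rectangle containing the path,
and whose first step is an east step. -/
def twoSidedPaths (L : ℕ) : Set (Fin (L + 1) → ℤ × ℤ) :=
  {π | π ∈ prudentPaths L ∧
    (∀ i : Fin L, ∀ p : ℤ × ℤ, p.1 ≤ 0 → p.2 ≤ 0 → ¬ OnRay π i p) ∧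
    (∀ i : Fin (L + 1), (π i).1 ≤ (π (Fin.last L)).1 ∧ (π i).2 ≤ (π (Fin.last L)).2) ∧
    (∀ i : Fin (L + 1), (i : ℕ) = 1 → π i = (1, 0))}

/-- The uniform law on `Ω_L⁺`. -/
noncomputable def unifTwoSided (L : ℕ) : MeasureTheory.Measure (Fin (L + 1) → ℤ × ℤ) :=
  ProbabilityTheory.uniformOn (twoSidedPaths L)

/-- The position `π_n`, as a point of the Euclidean plane. Times `n > L` are truncated to `L`;
in `rescaled`, for `t ∈ [0, 1]`, this occurs only at `t = 1`, with coefficient `0`. -/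
noncomputable def pos {L : ℕ} (π : Fin (L + 1) → ℤ × ℤ) (n : ℕ) : EuclideanSpace ℝ (Fin 2) :=
  let p : ℤ × ℤ := π ⟨min n L, Nat.lt_succ_of_le (min_le_right n L)⟩
  !₂[(p.1 : ℝ), (p.2 : ℝ)]

/-- The rescaled and linearly interpolated path
`π̃_t = L⁻¹ (π_⌊tL⌋ + (tL - ⌊tL⌋) (π_{⌊tL⌋+1} - π_⌊tL⌋))`, for `t ∈ [0, 1]`. -/
noncomputable def rescaled {L : ℕ} (π : Fin (L + 1) → ℤ × ℤ) (t : ℝ) :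
    EuclideanSpace ℝ (Fin 2) :=
  (L : ℝ)⁻¹ • (pos π ⌊t * L⌋₊ +
    (t * L - (⌊t * L⌋₊ : ℝ)) • (pos π (⌊t * L⌋₊ + 1) - pos π ⌊t * L⌋₊))

end PrudentWalk

/-!
A 2-sided prudent path always stays on the right or on the top side of its bounding box, so it can
be coded by an automaton with three moves relative to that side: out of the box (`fwd`), along the
side towards the top-right corner (`up`), and along the side away from it (`down`). The only
constraint is that `up` and `down` do not follow each other; an `up` move made at the corner leaves
the box and changes the side. The paths in question are exactly those that end with distance `k = 0`
to the corner (`path_mem_twoSidedPaths`, `exists_word`, `word_unique`).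

Give weight `z` to each move. The automaton has a positive harmonic function `weight z`, decaying
like `(2 z) ^ k`, exactly when `1 - 2 z - 2 z² + 2 z³ = 0`, and the corresponding Doob transform is a
Markov chain whose transition probabilities `prob z` depend on the last move only
(`IsCritical.weight_next`). The uniform law on the paths of length `n + 1` is, up to bounded
factors, this chain conditioned to be at the corner at time `n`:

* The number of paths is at least `η z⁻ⁿ` (`exists_le_card_cornerWords`). Indeed `z < √2 - 1`, so that
  away from the corner, where the automaton produces partially directed paths, the walk is
  subcritical; hence the distance to the corner has exponential tails uniformly in time
  (`mass_depth_le`), and from a bounded distance a corner is reached in a fixed number of steps.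
* The coordinates `x + y` and `x - y` become martingales with bounded increments after subtracting a
  linear drift, `speed z` and `0` per step, and a correction at most linear in `k`
  (`exists_isPoisson_sum`, `exists_isPoisson_diff`). Exponential martingale bounds and the tails of
  `k` make each deviation of order `n` exponentially unlikely (`IsPoisson.concentration`), and a
  union bound over the times up to `n` (`card_bad_le`) absorbs both the conditioning and the
  supremum.

So the law of large numbers holds with `c = speed z / 2`.
-/

namespace PrudentWalk

/-! ### The coding automaton -/

/-- The three moves of the coding automaton, relative to the side of the box on which the walk
currently lies: `fwd` leaves the box, `up` goes along the side towards the top-right corner,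
`down` goes along the side away from that corner. -/
inductive Move
  | fwd | up | down
  deriving DecidableEq

/-- A state of the coding automaton. The walk is at `p`, at distance `k` from the top-right corner
of the box, on the right side if `top = false` and on the top side if `top = true`; `last` is its
last move relative to that side. A step out of the box through the corner that changes the side
counts as `fwd`. -/
structure State where
  p : ℤ × ℤ
  top : Bool
  last : Move
  k : ℕ

/-- The reflection in the diagonal if `b = true`, the identity otherwise. It exchanges the top side
and the right side of the box. -/
def flip (b : Bool) (p : ℤ × ℤ) : ℤ × ℤ := if b then p.swap else p

/-- The effect of a move. An `up` move from the corner leaves the box and changes the side. -/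
def next (s : State) : Move → State
  | .fwd => ⟨s.p + flip s.top (1, 0), s.top, .fwd, s.k⟩
  | .down => ⟨s.p + flip s.top (0, -1), s.top, .down, s.k + 1⟩
  | .up => if s.k = 0 then ⟨s.p + flip s.top (0, 1), !s.top, .fwd, 0⟩
      else ⟨s.p + flip s.top (0, 1), s.top, .up, s.k - 1⟩

/-- The moves that do not turn back on the last one. -/
def allowed : Move → Finset Move
  | .fwd => {.fwd, .up, .down}
  | .up => {.fwd, .up}
  | .down => {.fwd, .down}

/-- The state reached after the first east step and a word of moves. Words are written backwards:
the head of the list is the last move. -/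
def run : List Move → State
  | [] => ⟨(1, 0), false, .fwd, 0⟩
  | m :: w => next (run w) m

/-- The words of `n` moves, each of them allowed. -/
def words : ℕ → Finset (List Move)
  | 0 => {[]}
  | n + 1 => (words n).biUnion fun w => (allowed (run w).last).image fun m => m :: w

lemma sum_words_succ (n : ℕ) (f : List Move → ℝ) :
    ∑ w ∈ words (n + 1), f w = ∑ w ∈ words n, ∑ m ∈ allowed (run w).last, f (m :: w) := by
  rw [words, Finset.sum_biUnion]
  · refine Finset.sum_congr rfl fun w _ => ?_
    rw [Finset.sum_image]
    simp
  · intro w _ w' _ hne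
    simp only [Function.onFun, Finset.disjoint_left, Finset.mem_image]
    rintro _ ⟨m, _, rfl⟩ ⟨m', _, h⟩
    exact hne (List.cons.inj h).2.symm

lemma mem_words_succ {n : ℕ} {l : List Move} :
    l ∈ words (n + 1) ↔ ∃ w ∈ words n, ∃ m ∈ allowed (run w).last, m :: w = l := by
  simp [words]

lemma length_of_mem_words {n : ℕ} {w : List Move} (hw : w ∈ words n) : w.length = n := by
  induction n generalizing w with
  | zero => simp [words] at hw; simp [hw]
  | succ n ih =>
    obtain ⟨w, hu, m, -, rfl⟩ := mem_words_succ.1 hw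
    simp [ih hu]

/-- The lattice path coded by a word `w`, constant after time `w.length + 1`. -/
def path : List Move → ℕ → ℤ × ℤ
  | [], i => if i = 0 then (0, 0) else (1, 0)
  | m :: w, i => if i ≤ w.length + 1 then path w i else (run (m :: w)).p

lemma path_zero (w : List Move) : path w 0 = (0, 0) := by
  induction w with
  | nil => simp [path]
  | cons m w ih => simp [path, ih]

lemma path_one (w : List Move) : path w 1 = (1, 0) := by
  induction w with
  | nil => simp [path]
  | cons m w ih => simp [path, ih]

lemma path_cons_of_le (m : Move) {w : List Move} {i : ℕ} (h : i ≤ w.length + 1) :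
    path (m :: w) i = path w i := by
  simp [path, h]

lemma path_length (w : List Move) : path w (w.length + 1) = (run w).p := by
  cases w <;> simp [path, run]

lemma path_succ (w : List Move) {j : ℕ} (hj : j ≤ w.length) :
    path w (j + 1) = (run (w.drop (w.length - j))).p := by
  induction w with
  | nil =>
    obtain rfl : j = 0 := by simpa using hj
    simp [path, run]
  | cons m w ih =>
    rcases Nat.lt_or_ge w.length j with h | h
    · obtain rfl : j = w.length + 1 := by simp at hj; omega
      have := path_length (m :: w)
      simpa using this
    · rw [path_cons_of_le m (by omega), ih h, List.length_cons, Nat.succ_sub h, List.drop_succ_cons]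

/-- The set of sites visited by the path coded by `w`. -/
def visited (w : List Move) : Set (ℤ × ℤ) := {v | ∃ j ≤ w.length + 1, path w j = v}

lemma visited_cons (m : Move) (w : List Move) :
    visited (m :: w) = insert (run (m :: w)).p (visited w) := by
  ext v
  simp only [visited, Set.mem_ofPred_eq, Set.mem_insert_iff, List.length_cons]
  constructor
  · rintro ⟨j, hj, rfl⟩
    rcases Nat.lt_or_ge (w.length + 1) j with h | h
    · obtain rfl : j = w.length + 1 + 1 := by omega
      exact Or.inl (path_length (m :: w))
    · exact Or.inr ⟨j, h, (path_cons_of_le m h).symm⟩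
  · rintro (rfl | ⟨j, hj, rfl⟩)
    · exact ⟨_, le_rfl, path_length (m :: w)⟩
    · exact ⟨j, by omega, path_cons_of_le m hj⟩

/-! ### Geometry of the box -/

/-- The ray from `p` in direction `v` avoids the set `V` and the quadrant `(-∞, 0]²`. -/
def Free (V : Set (ℤ × ℤ)) (p v : ℤ × ℤ) : Prop :=
  ∀ k : ℕ, 1 ≤ k → p + k • v ∉ V ∧ ¬((p + k • v).1 ≤ 0 ∧ (p + k • v).2 ≤ 0)

/-- What the last move says about the sites visited in the current column. -/
def ColumnInv (V : Set (ℤ × ℤ)) (p : ℤ × ℤ) : Move → Prop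
  | .fwd => ∀ v ∈ V, v.1 = p.1 → v.2 = p.2
  | .up => (∀ v ∈ V, v.1 = p.1 → v.2 ≤ p.2) ∧ (p.1, p.2 - 1) ∈ V
  | .down => (∀ v ∈ V, v.1 = p.1 → p.2 ≤ v.2) ∧ (p.1, p.2 + 1) ∈ V

/-- The invariant of a walk with visited set `V` that is now on the right side of its box, at
distance `k` below the corner. The field `rows` says that the walk cannot see the outside of the
box when it looks west. -/
structure RightInv (V : Set (ℤ × ℤ)) (p : ℤ × ℤ) (t : Move) (k : ℕ) : Prop where
  x_pos : 1 ≤ p.1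
  top_nonneg : 0 ≤ p.2 + k
  right : ∀ v ∈ V, v.1 ≤ p.1
  top : ∀ v ∈ V, v.2 ≤ p.2 + k
  rows : ∀ r, 0 ≤ r → r ≤ p.2 + k → ∃ v ∈ V, v.1 < p.1 ∧ v.2 = r
  cols : ∀ c, 0 ≤ c → c ≤ p.1 → ∃ v ∈ V, v.1 = c
  column : ColumnInv V p t

namespace RightInv

variable {V : Set (ℤ × ℤ)} {p : ℤ × ℤ} {t : Move} {k : ℕ}

lemma fwd (h : RightInv V p t k) :
    RightInv (insert (p + (1, 0)) V) (p + (1, 0)) .fwd k where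
  x_pos := by have := h.x_pos; simp; omega
  top_nonneg := by have := h.top_nonneg; simpa
  right := by
    rintro v (rfl | hv)
    · rfl
    · have := h.right v hv; simp; omega
  top := by
    rintro v (rfl | hv)
    · simp
    · have := h.top v hv; simpa
  rows r h0 h1 := by
    obtain ⟨v, hv, h2, h3⟩ := h.rows r h0 (by simpa using h1)
    exact ⟨v, Or.inr hv, by simp; omega, h3⟩
  cols c h0 h1 := by
    rcases lt_or_ge p.1 c with h2 | h2
    · exact ⟨_, Or.inl rfl, by simp at h1 ⊢; omega⟩
    · obtain ⟨v, hv, h3⟩ := h.cols c h0 h2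
      exact ⟨v, Or.inr hv, h3⟩
  column := by
    rintro v (rfl | hv) h1
    · rfl
    · have := h.right v hv
      simp at h1
      omega

lemma down (h : RightInv V p t k) (ht : t ≠ .up) (hp : p ∈ V) :
    RightInv (insert (p + (0, -1)) V) (p + (0, -1)) .down (k + 1) where
  x_pos := by have := h.x_pos; simpa
  top_nonneg := by have := h.top_nonneg; simp; omega
  right := by
    rintro v (rfl | hv)
    · rfl
    · have := h.right v hv; simpa
  top := by
    rintro v (rfl | hv)
    · simp; omega
    · have := h.top v hv; simp; omega
  rows r h0 h1 := by
    obtain ⟨v, hv, h2, h3⟩ := h.rows r h0 (by simp at h1; omega)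
    exact ⟨v, Or.inr hv, by simpa, h3⟩
  cols c h0 h1 := by
    obtain ⟨v, hv, h3⟩ := h.cols c h0 (by simpa using h1)
    exact ⟨v, Or.inr hv, h3⟩
  column := by
    refine ⟨?_, Or.inr (by simpa)⟩
    rintro v (rfl | hv) h1
    · rfl
    · simp at h1 ⊢
      have hc := h.column
      cases t with
      | fwd => have := hc v hv h1; omega
      | up => exact absurd rfl ht
      | down => have := hc.1 v hv h1; omega

lemma up_succ (h : RightInv V p t (k + 1)) (ht : t ≠ .down) (hp : p ∈ V) :
    RightInv (insert (p + (0, 1)) V) (p + (0, 1)) .up k where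
  x_pos := by have := h.x_pos; simpa
  top_nonneg := by have := h.top_nonneg; simp at this ⊢; omega
  right := by
    rintro v (rfl | hv)
    · rfl
    · have := h.right v hv; simpa
  top := by
    rintro v (rfl | hv)
    · simp
    · have := h.top v hv; simp at this ⊢; omega
  rows r h0 h1 := by
    obtain ⟨v, hv, h2, h3⟩ := h.rows r h0 (by simp at h1 ⊢; omega)
    exact ⟨v, Or.inr hv, by simpa, h3⟩
  cols c h0 h1 := by
    obtain ⟨v, hv, h3⟩ := h.cols c h0 (by simpa using h1)
    exact ⟨v, Or.inr hv, h3⟩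
  column := by
    refine ⟨?_, Or.inr (by simpa)⟩
    rintro v (rfl | hv) h1
    · rfl
    · simp at h1 ⊢
      have hc := h.column
      cases t with
      | fwd => have := hc v hv h1; omega
      | up => have := hc.1 v hv h1; omega
      | down => exact absurd rfl ht

/-- A step north from the corner puts the walk on the top side: after a reflection in the diagonal
the invariant holds again. -/
lemma up_zero (h : RightInv V p t 0) :
    RightInv {v | v.swap ∈ insert (p + (0, 1)) V} (p + (0, 1)).swap .fwd 0 where
  x_pos := by have := h.top_nonneg; simp at this ⊢; omega
  top_nonneg := by have := h.x_pos; simp; omega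
  right := by
    rintro v (hv | hv)
    · simp [← hv]
    · have := h.top _ hv; simp at this ⊢; omega
  top := by
    rintro v (hv | hv)
    · simp [← hv]
    · have := h.right _ hv; simpa using this
  rows r h0 h1 := by
    obtain ⟨v, hv, h3⟩ := h.cols r h0 (by simpa using h1)
    have := h.top v hv
    exact ⟨v.swap, Or.inr (by simpa), by simp at this ⊢; omega, by simpa⟩
  cols c h0 h1 := by
    rcases lt_or_ge p.2 c with h2 | h2
    · exact ⟨(p + (0, 1)).swap, Or.inl (by simp), by simp at h1 ⊢; omega⟩
    · obtain ⟨v, hv, -, h3⟩ := h.rows c h0 (by simpa)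
      exact ⟨v.swap, Or.inr (by simpa), by simpa⟩
  column := by
    rintro v (hv | hv) h1
    · simp [← hv]
    · have := h.top _ hv
      simp at h1 this
      omega

lemma free_fwd (h : RightInv V p t k) : Free V p (1, 0) := by
  intro j hj
  have := h.x_pos
  refine ⟨fun hv => ?_, fun hq => ?_⟩
  · have := h.right _ hv; simp at this; omega
  · have := hq.1; simp at this; omega

lemma free_down (h : RightInv V p t k) (ht : t ≠ .up) : Free V p (0, -1) := by
  intro j hj
  have := h.x_pos
  refine ⟨fun hv => ?_, fun hq => ?_⟩
  · have hc := h.column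
    cases t with
    | fwd => have := hc _ hv (by simp); simp at this; omega
    | up => exact absurd rfl ht
    | down => have := hc.1 _ hv (by simp); simp at this; omega
  · have := hq.1; simp at this; omega

lemma free_up (h : RightInv V p t k) (ht : t ≠ .down) : Free V p (0, 1) := by
  intro j hj
  have := h.x_pos
  refine ⟨fun hv => ?_, fun hq => ?_⟩
  · have hc := h.column
    cases t with
    | fwd => have := hc _ hv (by simp); simp at this; omega
    | up => have := hc.1 _ hv (by simp); simp at this; omega
    | down => exact absurd rfl ht
  · have := hq.1; simp at this; omega

lemma not_free_west (h : RightInv V p t k) : ¬ Free V p (-1, 0) := by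
  intro hf
  have hx := h.x_pos
  rcases lt_or_ge 0 p.2 with h0 | h0
  · obtain ⟨v, hv, h1, h2⟩ := h.rows p.2 h0.le (by omega)
    refine (hf (p.1 - v.1).toNat (by omega)).1 ?_
    convert hv using 1
    ext
    · simp; omega
    · simp [h2]
  · refine (hf p.1.toNat (by omega)).2 ⟨?_, ?_⟩
    · simp
    · simpa

lemma not_free_down (h : RightInv V p .up k) : ¬ Free V p (0, -1) := by
  intro hf
  refine (hf 1 le_rfl).1 ?_
  convert h.column.2 using 1
  ext <;> simp; omega

lemma not_free_up (h : RightInv V p .down k) : ¬ Free V p (0, 1) := by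
  intro hf
  refine (hf 1 le_rfl).1 ?_
  convert h.column.2 using 1
  ext <;> simp

end RightInv

lemma flip_flip (b : Bool) (p : ℤ × ℤ) : flip b (flip b p) = p := by
  cases b <;> simp [flip]

lemma flip_add (b : Bool) (p q : ℤ × ℤ) : flip b (p + q) = flip b p + flip b q := by
  cases b <;> simp [flip]

/-- The invariant of the automaton: `RightInv` up to a reflection in the diagonal. -/
structure Inv (V : Set (ℤ × ℤ)) (s : State) : Prop where
  mem : s.p ∈ V
  rightInv : RightInv {v | flip s.top v ∈ V} (flip s.top s.p) s.last s.k

lemma free_flip {b : Bool} {V : Set (ℤ × ℤ)} {p v : ℤ × ℤ} :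
    Free {x | flip b x ∈ V} (flip b p) (flip b v) ↔ Free V p v := by
  cases b
  · simp [flip, Free]
  · have key : ∀ j : ℕ, p.swap + j • v.swap = (p + j • v).swap := fun j => by ext <;> simp
    simp only [flip, Free, if_true, key, Set.mem_ofPred_eq, Prod.swap_swap, Prod.fst_swap,
      Prod.snd_swap, and_comm]

lemma mem_allowed_up {t : Move} : .up ∈ allowed t ↔ t ≠ .down := by
  cases t <;> simp [allowed]

lemma mem_allowed_down {t : Move} : .down ∈ allowed t ↔ t ≠ .up := by
  cases t <;> simp [allowed]

lemma fwd_mem_allowed (t : Move) : .fwd ∈ allowed t := by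
  cases t <;> simp [allowed]

lemma setOf_flip_mem_insert (b : Bool) (V : Set (ℤ × ℤ)) (p v : ℤ × ℤ) :
    {x | flip b x ∈ insert (p + flip b v) V} = insert (flip b p + v) {x | flip b x ∈ V} := by
  ext x
  have : flip b x = p + flip b v ↔ x = flip b p + v := by
    constructor
    · intro h
      rw [← flip_flip b x, h, flip_add, flip_flip]
    · rintro rfl
      rw [flip_add, flip_flip]
  simp [this]

lemma Inv.next {V : Set (ℤ × ℤ)} {s : State} (h : Inv V s) {m : Move} (hm : m ∈ allowed s.last) :
    Inv (insert (next s m).p V) (next s m) := by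
  refine ⟨Or.inl rfl, ?_⟩
  obtain ⟨hp, h⟩ := h
  have hp' : flip s.top s.p ∈ {v | flip s.top v ∈ V} := by simpa [flip_flip]
  cases m with
  | fwd =>
    simp only [PrudentWalk.next, setOf_flip_mem_insert, flip_add, flip_flip]
    exact h.fwd
  | down =>
    simp only [PrudentWalk.next, setOf_flip_mem_insert, flip_add, flip_flip]
    exact h.down (mem_allowed_down.1 hm) hp'
  | up =>
    obtain ⟨p, b, t, k⟩ := s
    cases k with
    | zero =>
      simp only [PrudentWalk.next, if_true]
      have := h.up_zero
      convert this using 1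
      · ext v
        have : flip (!b) v = flip b v.swap := by cases b <;> simp [flip]
        simp only [Set.mem_ofPred_eq, this]
        have h2 := Set.ext_iff.1 (setOf_flip_mem_insert b V p (0, 1)) v.swap
        simpa using h2
      · cases b <;> simp [flip]
    | succ k =>
      simp only [PrudentWalk.next, Nat.succ_ne_zero, if_false, setOf_flip_mem_insert, flip_add,
        flip_flip, Nat.add_sub_cancel]
      exact h.up_succ (mem_allowed_up.1 hm) hp'

lemma next_p (s : State) (m : Move) :
    (next s m).p = s.p + flip s.top (match m with
      | .fwd => (1, 0) | .up => (0, 1) | .down => (0, -1)) := by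
  cases m <;> simp only [next]
  split_ifs <;> rfl

lemma next_p_injective (s : State) : Function.Injective fun m => (next s m).p := by
  intro m m' h
  simp only [next_p, add_right_inj] at h
  have h' := congrArg (flip s.top) h
  rw [flip_flip, flip_flip] at h'
  cases m <;> cases m' <;> simp_all

lemma Inv.free_next {V : Set (ℤ × ℤ)} {s : State} (h : Inv V s) {m : Move}
    (hm : m ∈ allowed s.last) : Free V s.p ((PrudentWalk.next s m).p - s.p) := by
  rw [next_p, add_sub_cancel_left, ← free_flip (b := s.top), flip_flip]
  cases m with
  | fwd => exact h.rightInv.free_fwd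
  | up => exact h.rightInv.free_up (mem_allowed_up.1 hm)
  | down => exact h.rightInv.free_down (mem_allowed_down.1 hm)

lemma isUnitStep_flip {b : Bool} {v : ℤ × ℤ} : IsUnitStep (flip b v) ↔ IsUnitStep v := by
  cases b
  · simp [flip]
  · simp only [flip, IsUnitStep, if_true, Prod.ext_iff, Prod.fst_swap, Prod.snd_swap]
    omega

lemma isUnitStep_next (s : State) (m : Move) : IsUnitStep ((next s m).p - s.p) := by
  rw [next_p, add_sub_cancel_left, isUnitStep_flip]
  cases m <;> simp [IsUnitStep]

/-- Every prudent step is an allowed move of the automaton. -/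
lemma Inv.exists_next {V : Set (ℤ × ℤ)} {s : State} (h : Inv V s) {v : ℤ × ℤ} (hv : IsUnitStep v)
    (hf : Free V s.p v) : ∃ m ∈ allowed s.last, (PrudentWalk.next s m).p = s.p + v := by
  rw [← free_flip (b := s.top)] at hf
  rw [← isUnitStep_flip (b := s.top)] at hv
  suffices ∃ m ∈ allowed s.last, flip s.top v = (match m with
      | .fwd => (1, 0) | .up => (0, 1) | .down => (0, -1) : ℤ × ℤ) by
    obtain ⟨m, hm, h1⟩ := this
    exact ⟨m, hm, by rw [next_p, ← h1, flip_flip]⟩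
  have hr := h.rightInv
  rcases hv with hv | hv | hv | hv <;> rw [hv] at hf ⊢
  · exact ⟨.fwd, fwd_mem_allowed _, rfl⟩
  · exact absurd hf hr.not_free_west
  · refine ⟨.up, mem_allowed_up.2 fun ht => ?_, rfl⟩
    rw [ht] at hr
    exact hr.not_free_up hf
  · refine ⟨.down, mem_allowed_down.2 fun ht => ?_, rfl⟩
    rw [ht] at hr
    exact hr.not_free_down hf

/-- The walk is at the top-right corner of its box if and only if `k = 0`. -/
lemma Inv.corner_iff {V : Set (ℤ × ℤ)} {s : State} (h : Inv V s) :
    s.k = 0 ↔ ∀ v ∈ V, v.1 ≤ s.p.1 ∧ v.2 ≤ s.p.2 := by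
  obtain ⟨p, b, t, k⟩ := s
  have hr := h.rightInv
  constructor
  · rintro rfl v hv
    have h1 := hr.right (flip b v) (by simpa [flip_flip])
    have h2 := hr.top (flip b v) (by simpa [flip_flip])
    cases b <;> simp [flip] at h1 h2 ⊢ <;> omega
  · intro h1
    obtain ⟨v, hv, -, h2⟩ := hr.rows _ hr.top_nonneg le_rfl
    have := h1 _ hv
    cases b <;> simp [flip] at this h2 ⊢ <;> omega

lemma inv_visited {n : ℕ} {w : List Move} (hw : w ∈ words n) : Inv (visited w) (run w) := by
  induction n generalizing w with
  | zero =>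
    obtain rfl : w = [] := by simpa [words] using hw
    have h0 : ((0, 0) : ℤ × ℤ) ∈ visited [] := ⟨0, by simp, by simp [path]⟩
    have h1 : ((1, 0) : ℤ × ℤ) ∈ visited [] := ⟨1, by simp, by simp [path]⟩
    have h2 : ∀ v ∈ visited [], v = (0, 0) ∨ v = (1, 0) := by
      rintro v ⟨j, -, rfl⟩
      by_cases h : j = 0 <;> simp [path, h]
    refine ⟨h1, ?_⟩
    simp only [run, flip, Bool.false_eq_true, if_false]
    refine ⟨le_rfl, by simp, ?_, ?_, ?_, ?_, ?_⟩
    · intro v hv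
      rcases h2 v hv with rfl | rfl <;> simp
    · intro v hv
      rcases h2 v hv with rfl | rfl <;> simp
    · intro r hr hr'
      exact ⟨_, h0, by simp, by simp at hr' ⊢; omega⟩
    · intro c hc hc'
      rcases hc.lt_or_eq with h | rfl
      · exact ⟨_, h1, by simp at hc' ⊢; omega⟩
      · exact ⟨_, h0, rfl⟩
    · intro v hv _
      rcases h2 v hv with rfl | rfl <;> simp
  | succ n ih =>
    obtain ⟨w, hu, m, hm, rfl⟩ := mem_words_succ.1 hw
    clear hw
    rename' hu => hw
    rw [visited_cons]
    exact (ih hw).next hm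

/-! ### Coding of the prudent paths -/

/-- The path coded by a word is prudent. -/
lemma path_step {n : ℕ} {w : List Move} (hw : w ∈ words n) {i : ℕ} (hi : i ≤ n) :
    IsUnitStep (path w (i + 1) - path w i) ∧
      Free {v | ∃ j ≤ i, path w j = v} (path w i) (path w (i + 1) - path w i) := by
  rcases Nat.eq_zero_or_pos i with rfl | hi0
  · simp only [zero_add, path_zero, path_one]
    refine ⟨by simp [IsUnitStep], fun k hk => ⟨?_, ?_⟩⟩
    · rintro ⟨j, hj, h⟩
      obtain rfl : j = 0 := by omega
      simp [path_zero] at h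
      omega
    · simp; omega
  induction n generalizing w with
  | zero => omega
  | succ n ih =>
    obtain ⟨w, hu, m, hm, rfl⟩ := mem_words_succ.1 hw
    clear hw
    rename' hu => hw
    have hl := length_of_mem_words hw
    rcases Nat.lt_or_ge n i with h | h
    · obtain rfl : i = n + 1 := by omega
      have e1 : path (m :: w) (n + 1 + 1) = (next (run w) m).p := by
        have := path_length (m :: w)
        rwa [List.length_cons, hl] at this
      have e2 : path (m :: w) (n + 1) = (run w).p := by
        rw [path_cons_of_le m (by omega), ← hl, path_length]
      have e3 : {v | ∃ j ≤ n + 1, path (m :: w) j = v} = visited w := by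
        ext v
        simp only [visited, Set.mem_ofPred_eq, hl]
        refine exists_congr fun j => and_congr_right fun hj => ?_
        rw [path_cons_of_le m (by omega)]
      rw [e1, e2, e3]
      exact ⟨isUnitStep_next _ _, (inv_visited hw).free_next hm⟩
    · have e : ∀ j, j ≤ i + 1 → path (m :: w) j = path w j := fun j hj =>
        path_cons_of_le m (by omega)
      have e3 : {v | ∃ j ≤ i, path (m :: w) j = v} = {v | ∃ j ≤ i, path w j = v} := by
        ext v
        refine exists_congr fun j => and_congr_right fun hj => ?_
        rw [e j (by omega)]
      rw [e _ le_rfl, e i (by omega), e3]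
      exact ih hw h

/-- A word whose path ends at the corner of its box codes a 2-sided prudent path. -/
lemma path_mem_twoSidedPaths {n : ℕ} {w : List Move} (hw : w ∈ words n) (hk : (run w).k = 0) :
    (fun i : Fin (n + 1 + 1) => path w i) ∈ twoSidedPaths (n + 1) := by
  refine ⟨⟨path_zero w, fun i => ?_, fun i j hj => ?_⟩, fun i p h1 h2 => ?_, fun i => ?_, ?_⟩
  · simpa using (path_step hw (i := i) (by omega)).1
  · rintro ⟨k, hk1, hk2⟩
    refine ((path_step hw (i := i) (by omega)).2 k hk1).1 ⟨j, ?_, ?_⟩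
    · simpa [Fin.le_def] using hj
    · simpa using hk2
  · rintro ⟨k, hk1, hk2⟩
    refine ((path_step hw (i := i) (by omega)).2 k hk1).2 ?_
    have e : p = path w i + k • (path w (i + 1) - path w i) := by simpa using hk2
    rw [← e]
    exact ⟨h1, h2⟩
  · have hl := length_of_mem_words hw
    have := (inv_visited hw).corner_iff.1 hk (path w i) ⟨i, by omega, rfl⟩
    have e := path_length w
    rw [hl] at e
    simpa [e] using this
  · intro i hi
    simp [hi, path_one]

/-- Every 2-sided prudent path is coded by a word. -/
lemma exists_word {n : ℕ} {π : Fin (n + 1 + 1) → ℤ × ℤ} (hπ : π ∈ twoSidedPaths (n + 1)) :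
    ∃ w ∈ words n, (run w).k = 0 ∧ (fun i : Fin (n + 1 + 1) => path w i) = π := by
  obtain ⟨⟨h0, hu, hp⟩, hq, hc, h1⟩ := hπ
  have key : ∀ m ≤ n, ∃ w ∈ words m, ∀ i : Fin (n + 1 + 1), (i : ℕ) ≤ m + 1 → path w i = π i := by
    intro m
    induction m with
    | zero =>
      refine fun _ => ⟨[], by simp [words], fun i hi => ?_⟩
      rcases Nat.eq_zero_or_pos (i : ℕ) with h | h
      · obtain rfl : i = 0 := Fin.ext h
        simp [path, h0]
      · have h2 : (i : ℕ) = 1 := by omega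
        rw [h1 i h2, h2, path_one]
    | succ m ih =>
      intro hm
      obtain ⟨w, hw, hwp⟩ := ih (by omega)
      have hl := length_of_mem_words hw
      set i : Fin (n + 1) := ⟨m + 1, by omega⟩ with hi
      have e : (run w).p = π i.castSucc := by
        rw [← path_length, hl]
        exact hwp i.castSucc le_rfl
      have hf : Free (visited w) (run w).p (π i.succ - π i.castSucc) := by
        intro k hk
        rw [e]
        refine ⟨?_, fun h => hq i _ h.1 h.2 ⟨k, hk, rfl⟩⟩
        rintro ⟨j, hj, hj'⟩
        refine hp i ⟨j, by omega⟩ (by simp [Fin.le_def, hi]; omega) ⟨k, hk, ?_⟩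
        rw [← hwp _ (by simp; omega), ← hj']
      obtain ⟨a, ha, hap⟩ := (inv_visited hw).exists_next (hu i) hf
      refine ⟨a :: w, mem_words_succ.2 ⟨w, hw, a, ha, rfl⟩, fun j hj => ?_⟩
      rcases Nat.lt_or_ge (m + 1) j with h | h
      · obtain rfl : j = i.succ := Fin.ext (by simp [hi]; omega)
        have := path_length (a :: w)
        rw [List.length_cons, hl] at this
        simp only [Fin.val_succ, hi]
        rw [this, run, hap, e]
        abel
      · rw [path_cons_of_le a (by omega), hwp j h]
  obtain ⟨w, hw, hwp⟩ := key n le_rfl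
  have hl := length_of_mem_words hw
  refine ⟨w, hw, ?_, funext fun i => hwp i (by omega)⟩
  refine (inv_visited hw).corner_iff.2 ?_
  rintro _ ⟨j, hj, rfl⟩
  have h2 := hwp ⟨j, by omega⟩ (by simp; omega)
  have h3 := hwp (Fin.last _) (by simp)
  simp only [Fin.val_last] at h2 h3
  have e := path_length w
  rw [hl] at e
  rw [← e, h2, h3]
  exact hc _

/-- A path is coded by at most one word, because the automaton is deterministic. -/
lemma word_unique {n : ℕ} {w w' : List Move} (hw : w ∈ words n) (hw' : w' ∈ words n)
    (h : ∀ i ≤ n + 1, path w i = path w' i) : w = w' := by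
  induction n generalizing w w' with
  | zero => simp [words] at hw hw'; rw [hw, hw']
  | succ n ih =>
    obtain ⟨w, hu, m, hm, rfl⟩ := mem_words_succ.1 hw
    clear hw
    rename' hu => hw
    obtain ⟨w', hu', m', hm', rfl⟩ := mem_words_succ.1 hw'
    clear hw'
    rename' hu' => hw'
    have hl := length_of_mem_words hw
    have hl' := length_of_mem_words hw'
    obtain rfl : w = w' := by
      refine ih hw hw' fun i hi => ?_
      have := h i (by omega)
      rwa [path_cons_of_le m (by omega), path_cons_of_le m' (by omega)] at this
    have e := path_length (m :: w)
    have e' := path_length (m' :: w)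
    rw [List.length_cons, hl] at e e'
    have h2 := h (n + 1 + 1) le_rfl
    rw [e, e'] at h2
    rw [next_p_injective (run w) h2]

/-! ### The critical weight and the Markov chain it defines -/

/-- The critical weight per step: the inverse of the growth rate of the 2-sided prudent paths. The
upper bound, sharper than needed to single out the root, makes `z` smaller than the critical weight
`√2 - 1` of partially directed paths. -/
structure IsCritical (z : ℝ) : Prop where
  root : 1 - 2 * z - 2 * z ^ 2 + 2 * z ^ 3 = 0
  lo : 2 / 5 < z
  hi : z < 4031 / 10000

lemma exists_isCritical : ∃ z, IsCritical z := by
  have hc : ContinuousOn (fun z : ℝ => 1 - 2 * z - 2 * z ^ 2 + 2 * z ^ 3)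
      (Set.Icc (2 / 5) (4031 / 10000)) := by fun_prop
  obtain ⟨z, hz, h0⟩ := intermediate_value_Ioo' (by norm_num) hc
    (show (0 : ℝ) ∈ Set.Ioo _ _ by constructor <;> norm_num)
  exact ⟨z, h0, hz.1, hz.2⟩

/-- The dependence of `weight` on the last move. -/
noncomputable def coeff (z : ℝ) : Move → ℝ
  | .fwd => 1
  | .up => 2 * z
  | .down => z / (1 - 2 * z ^ 2)

/-- The positive harmonic function of the automaton: when each move has weight `z`, it is, up to
normalization, the asymptotic weight of the words that lead from `s` to a corner. -/
noncomputable def weight (z : ℝ) (s : State) : ℝ := (2 * z) ^ s.k * coeff z s.last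

/-- The transition probabilities obtained from the weight `z` per move and the harmonic function
`weight z`. They depend on the last move only. -/
noncomputable def prob (z : ℝ) : Move → Move → ℝ
  | .fwd, .fwd => z
  | .fwd, .up => z
  | .fwd, .down => 1 - 2 * z
  | .up, .fwd => 1 / 2
  | .up, .up => 1 / 2
  | .up, .down => 0
  | .down, .fwd => 1 - 2 * z ^ 2
  | .down, .up => 0
  | .down, .down => 2 * z ^ 2

/-- The total weight at time `n` of `f`, for the Markov chain with transition probabilities
`prob z`. -/
noncomputable def mean (z : ℝ) (n : ℕ) (f : List Move → ℝ) : ℝ :=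
  ∑ w ∈ words n, z ^ n * weight z (run w) * f w

/-- The mean of the indicator function of `P`. -/
noncomputable def mass (z : ℝ) (n : ℕ) (P : List Move → Prop) : ℝ :=
  mean z n (Set.indicator {w | P w} 1)

variable {z : ℝ}

namespace IsCritical

lemma pos (hz : IsCritical z) : 0 < z := by linarith [hz.lo]

lemma sq_lt (hz : IsCritical z) : z ^ 2 < 1 / 5 := by
  nlinarith [hz.lo, hz.hi]

lemma coeff_pos (hz : IsCritical z) (t : Move) : 0 < coeff z t := by
  have := hz.pos
  have := hz.sq_lt
  cases t
  · simp [coeff]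
  · simpa [coeff]
  · exact div_pos hz.pos (by linarith)

lemma half_le_coeff (hz : IsCritical z) (t : Move) : 1 / 2 ≤ coeff z t := by
  have h1 := hz.lo
  have h2 := hz.sq_lt
  cases t
  · norm_num [coeff]
  · simp only [coeff]; linarith
  · rw [coeff, le_div_iff₀ (by linarith)]
    nlinarith

lemma coeff_le_one (hz : IsCritical z) (t : Move) : coeff z t ≤ 1 := by
  have h1 := hz.hi
  have h2 := hz.sq_lt
  cases t
  · norm_num [coeff]
  · simp only [coeff]; linarith
  · rw [coeff, div_le_one (by linarith)]
    linarith

lemma weight_pos (hz : IsCritical z) (s : State) : 0 < weight z s :=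
  mul_pos (pow_pos (by linarith [hz.pos]) _) (hz.coeff_pos _)

lemma weight_le_pow (hz : IsCritical z) (s : State) : weight z s ≤ (2 * z) ^ s.k :=
  mul_le_of_le_one_right (pow_nonneg (by linarith [hz.pos]) _) (hz.coeff_le_one _)

lemma weight_le_one (hz : IsCritical z) (s : State) : weight z s ≤ 1 :=
  (hz.weight_le_pow s).trans (pow_le_one₀ (by linarith [hz.pos]) (by linarith [hz.hi]))

lemma prob_nonneg (hz : IsCritical z) (t m : Move) : 0 ≤ prob z t m := by
  have := hz.pos
  have := hz.hi
  have := hz.sq_lt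
  cases t <;> cases m <;> simp only [prob] <;> nlinarith

lemma weight_next (hz : IsCritical z) (s : State) {m : Move} (hm : m ∈ allowed s.last) :
    z * weight z (next s m) = prob z s.last m * weight z s := by
  obtain ⟨p, b, t, k⟩ := s
  have h1 : 1 - 2 * z ^ 2 ≠ 0 := by have := hz.sq_lt; intro h; linarith
  have hA : z / (1 - 2 * z ^ 2) * (1 - 2 * z ^ 2) = z := div_mul_cancel₀ _ h1
  set A := z / (1 - 2 * z ^ 2) with hA'
  have hd : 2 * z ^ 2 * A = 1 - 2 * z := by
    refine mul_right_cancel₀ h1 ?_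
    linear_combination 2 * z ^ 2 * hA - hz.root
  cases t <;> cases m <;> simp [allowed] at hm
  · simp only [next, weight, coeff, prob]
  · cases k <;> simp [next, weight, coeff, prob, pow_succ]
  · simp only [next, weight, coeff, prob, ← hA']
    linear_combination (2 * z) ^ k * hd
  · simp only [next, weight, coeff, prob]
    ring
  · cases k <;> simp [next, weight, coeff, prob, pow_succ]
    ring
  · simp only [next, weight, coeff, prob, ← hA']
    linear_combination -(2 * z) ^ k * hA
  · simp only [next, weight, coeff, prob, ← hA']
    ring

end IsCritical

lemma sum_prob (z : ℝ) (t : Move) : ∑ m ∈ allowed t, prob z t m = 1 := by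
  cases t <;> simp [allowed, prob] <;> ring

lemma mean_succ (hz : IsCritical z) (n : ℕ) (f : List Move → ℝ) :
    mean z (n + 1) f =
      mean z n fun w => ∑ m ∈ allowed (run w).last, prob z (run w).last m * f (m :: w) := by
  rw [mean, sum_words_succ, mean]
  refine Finset.sum_congr rfl fun w _ => ?_
  rw [Finset.mul_sum]
  refine Finset.sum_congr rfl fun m hm => ?_
  rw [run, pow_succ, mul_assoc (z ^ n), hz.weight_next _ hm]
  ring

lemma mean_mono (hz : IsCritical z) {n : ℕ} {f g : List Move → ℝ} (h : ∀ w ∈ words n, f w ≤ g w) :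
    mean z n f ≤ mean z n g :=
  Finset.sum_le_sum fun w hw => mul_le_mul_of_nonneg_left (h w hw)
    (mul_nonneg (pow_nonneg hz.pos.le _) (hz.weight_pos _).le)

lemma mean_const_mul (z : ℝ) (n : ℕ) (a : ℝ) (f : List Move → ℝ) :
    mean z n (fun w => a * f w) = a * mean z n f := by
  rw [mean, mean, Finset.mul_sum]
  exact Finset.sum_congr rfl fun w _ => by ring

lemma mean_add (z : ℝ) (n : ℕ) (f g : List Move → ℝ) :
    mean z n (fun w => f w + g w) = mean z n f + mean z n g := by
  simp only [mean, mul_add, Finset.sum_add_distrib]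

lemma mean_one (hz : IsCritical z) (n : ℕ) : mean z n 1 = 1 := by
  induction n with
  | zero => simp [mean, words, run, weight, coeff]
  | succ n ih =>
    rw [mean_succ hz]
    simp only [Pi.one_apply, mul_one, sum_prob]
    exact ih

/-- The Markov property: an observable of the first `n` moves has the same mean at time `n` and at
any later time. -/
lemma mean_drop (hz : IsCritical z) (n j : ℕ) (f : List Move → ℝ) :
    mean z (n + j) (fun w => f (w.drop j)) = mean z n f := by
  induction j with
  | zero => rfl
  | succ j ih =>
    rw [← add_assoc, mean_succ hz, ← ih]
    simp [← Finset.sum_mul, sum_prob]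

lemma mass_le_mean (hz : IsCritical z) {n : ℕ} {P : List Move → Prop} {f : List Move → ℝ}
    (h0 : ∀ w ∈ words n, 0 ≤ f w) (h1 : ∀ w ∈ words n, P w → 1 ≤ f w) :
    mass z n P ≤ mean z n f := by
  refine mean_mono hz fun w hw => ?_
  by_cases h : P w
  · simpa [h] using h1 w hw h
  · simpa [h] using h0 w hw

lemma indicator_nonneg (P : List Move → Prop) (w : List Move) :
    (0 : ℝ) ≤ Set.indicator {w | P w} 1 w :=
  Set.indicator_nonneg (fun _ _ => zero_le_one) _

lemma mass_le_one (hz : IsCritical z) (n : ℕ) (P : List Move → Prop) : mass z n P ≤ 1 :=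
  (mass_le_mean hz (f := 1) (fun _ _ => zero_le_one) fun _ _ _ => le_rfl).trans
    (mean_one hz n).le

lemma mass_le_add (hz : IsCritical z) {n : ℕ} {P Q R : List Move → Prop}
    (h : ∀ w ∈ words n, P w → Q w ∨ R w) : mass z n P ≤ mass z n Q + mass z n R := by
  unfold mass
  rw [← mean_add]
  change mass z n P ≤ _
  refine mass_le_mean hz (fun w _ => add_nonneg (indicator_nonneg Q w) (indicator_nonneg R w))
    fun w hw hP => ?_
  have h1 := indicator_nonneg Q w
  have h2 := indicator_nonneg R w
  rcases h w hw hP with h | h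
  · have : Set.indicator {w | Q w} (1 : List Move → ℝ) w = 1 := by simp [h]
    linarith
  · have : Set.indicator {w | R w} (1 : List Move → ℝ) w = 1 := by simp [h]
    linarith

/-! ### Exponential bounds -/

/-- A weight on the moves for which the partially directed paths are subcritical. -/
noncomputable def moveWeight : Move → ℝ
  | .fwd => 1
  | .up => 7 / 10
  | .down => 7 / 10

/-- Without the constraint to return to the corner, the words of length `n` still have bounded total
weight: away from the corner the automaton produces partially directed paths, whose growth rate
`1 + √2` is less than `1 / z`. -/
lemma sum_moveWeight_le (hz : IsCritical z) (n : ℕ) :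
    ∑ w ∈ words n, z ^ n * moveWeight (run w).last ≤ 50 := by
  induction n with
  | zero => simp [words, run, moveWeight]
  | succ n ih =>
    have step : ∀ s : State, z * ∑ m ∈ allowed s.last, moveWeight (next s m).last ≤
        98 / 100 * moveWeight s.last + weight z s := by
      intro s
      have h1 := hz.pos
      have h2 := hz.hi
      have h3 := hz.weight_pos s
      obtain ⟨p, b, t, k⟩ := s
      cases t <;> cases k <;> simp [allowed, moveWeight, next] <;>
        simp [weight, coeff] at h3 ⊢ <;> linarith
    have h1 : ∑ w ∈ words n, z ^ n * weight z (run w) = 1 := by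
      simpa [mean] using mean_one hz n
    rw [sum_words_succ]
    calc ∑ w ∈ words n, ∑ m ∈ allowed (run w).last,
          z ^ (n + 1) * moveWeight (run (m :: w)).last
        ≤ ∑ w ∈ words n,
          (98 / 100 * (z ^ n * moveWeight (run w).last) + z ^ n * weight z (run w)) := by
          refine Finset.sum_le_sum fun w _ => ?_
          have := mul_le_mul_of_nonneg_left (step (run w)) (pow_nonneg hz.pos.le n)
          rw [← Finset.mul_sum, pow_succ]
          simp only [run]
          linarith
      _ = 98 / 100 * ∑ w ∈ words n, z ^ n * moveWeight (run w).last + 1 := by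
          rw [Finset.sum_add_distrib, ← Finset.mul_sum, h1]
      _ ≤ 50 := by linarith

/-- The distance to the corner has exponential tails, uniformly in time. -/
lemma mass_depth_le (hz : IsCritical z) (n : ℕ) (x : ℝ) :
    mass z n (fun w => x ≤ (run w).k) ≤ 100 * Real.exp (x * Real.log (2 * z)) := by
  have h0 : 0 < 2 * z := by linarith [hz.pos]
  have h1 : Real.log (2 * z) ≤ 0 := Real.log_nonpos h0.le (by linarith [hz.hi])
  have hE := (Real.exp_pos (x * Real.log (2 * z))).le
  calc mass z n (fun w => x ≤ (run w).k)
      ≤ ∑ w ∈ words n,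
        2 * Real.exp (x * Real.log (2 * z)) * (z ^ n * moveWeight (run w).last) := by
        refine Finset.sum_le_sum fun w _ => ?_
        have hm : 1 / 2 ≤ moveWeight (run w).last := by
          cases (run w).last <;> norm_num [moveWeight]
        have hzn := pow_nonneg hz.pos.le n
        by_cases h : x ≤ (run w).k
        · have h2 : (2 * z) ^ (run w).k ≤ Real.exp (x * Real.log (2 * z)) := by
            rw [← Real.exp_log (pow_pos h0 _), Real.log_pow, Real.exp_le_exp]
            exact mul_le_mul_of_nonpos_right h h1
          have h3 := (hz.weight_le_pow (run w)).trans h2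
          have h4 : weight z (run w) ≤
              2 * Real.exp (x * Real.log (2 * z)) * moveWeight (run w).last := by nlinarith
          have := mul_le_mul_of_nonneg_left h4 hzn
          simp only [Set.indicator, Set.mem_ofPred_eq, h, if_true, Pi.one_apply, mul_one]
          linarith
        · simp only [Set.indicator, Set.mem_ofPred_eq, h, if_false, mul_zero]
          positivity
    _ = 2 * Real.exp (x * Real.log (2 * z)) * ∑ w ∈ words n, z ^ n * moveWeight (run w).last := by
        rw [Finset.mul_sum]
    _ ≤ 100 * Real.exp (x * Real.log (2 * z)) := by
        have := mul_le_mul_of_nonneg_left (sum_moveWeight_le hz n) (by positivity :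
          0 ≤ 2 * Real.exp (x * Real.log (2 * z)))
        linarith

/-- A solution `Φ` of the Poisson equation `P Φ - Φ = μ` for the Markov chain, with bounded
increments, i.e. `Φ` minus `μ` times the time is a martingale. -/
structure IsPoisson (z : ℝ) (Φ : State → ℝ) (μ B : ℝ) : Prop where
  drift : ∀ s, ∑ m ∈ allowed s.last, prob z s.last m * (Φ (next s m) - Φ s - μ) = 0
  bound : ∀ s, ∀ m ∈ allowed s.last, |Φ (next s m) - Φ s - μ| ≤ B

lemma IsPoisson.neg {Φ : State → ℝ} {μ B : ℝ} (h : IsPoisson z Φ μ B) :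
    IsPoisson z (fun s => -Φ s) (-μ) B where
  drift s := by
    rw [← neg_eq_zero, ← Finset.sum_neg_distrib, ← h.drift s]
    exact Finset.sum_congr rfl fun m _ => by ring
  bound s m hm := by
    rw [← abs_neg]
    convert h.bound s m hm using 2
    ring

lemma IsPoisson.mean_exp_le {Φ : State → ℝ} {μ B : ℝ} (hz : IsCritical z) (h : IsPoisson z Φ μ B)
    {σ : ℝ} (hσ : 0 ≤ σ) (hB : σ * B ≤ 1) (n : ℕ) :
    mean z n (fun w => Real.exp (σ * (Φ (run w) - Φ (run []) - μ * n))) ≤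
      Real.exp (n * (σ * B) ^ 2) := by
  induction n with
  | zero => simp [mean, words, run, weight, coeff]
  | succ n ih =>
    have hB0 : ∀ s, ∀ m ∈ allowed s.last, |σ * (Φ (next s m) - Φ s - μ)| ≤ σ * B := fun s m hm => by
      rw [abs_mul, abs_of_nonneg hσ]
      exact mul_le_mul_of_nonneg_left (h.bound s m hm) hσ
    have step : ∀ s, ∑ m ∈ allowed s.last,
        prob z s.last m * Real.exp (σ * (Φ (next s m) - Φ s - μ)) ≤ Real.exp ((σ * B) ^ 2) := by
      intro s
      calc _ ≤ ∑ m ∈ allowed s.last, (prob z s.last m * (1 + (σ * B) ^ 2) +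
              σ * (prob z s.last m * (Φ (next s m) - Φ s - μ))) := by
            refine Finset.sum_le_sum fun m hm => ?_
            set x := σ * (Φ (next s m) - Φ s - μ) with hx
            have h1 := hB0 s m hm
            have h2 := (abs_le.1 (Real.abs_exp_sub_one_sub_id_le (h1.trans hB))).2
            have h3 : x ^ 2 ≤ (σ * B) ^ 2 := by
              rw [← sq_abs]
              exact pow_le_pow_left₀ (abs_nonneg _) h1 2
            have h4 : Real.exp x ≤ 1 + (σ * B) ^ 2 + x := by linarith
            have := mul_le_mul_of_nonneg_left h4 (hz.prob_nonneg s.last m)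
            calc _ ≤ _ := this
              _ = _ := by rw [hx]; ring
        _ = 1 + (σ * B) ^ 2 := by
            rw [Finset.sum_add_distrib, ← Finset.sum_mul, ← Finset.mul_sum, h.drift, sum_prob]
            ring
        _ ≤ _ := by linarith [Real.add_one_le_exp ((σ * B) ^ 2)]
    rw [mean_succ hz]
    calc _ ≤ mean z n (fun w => Real.exp ((σ * B) ^ 2) *
            Real.exp (σ * (Φ (run w) - Φ (run []) - μ * n))) := by
          refine mean_mono hz fun w _ => ?_
          refine le_trans (le_of_eq ?_)
            (mul_le_mul_of_nonneg_right (step (run w)) (Real.exp_pos _).le)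
          rw [Finset.sum_mul]
          refine Finset.sum_congr rfl fun m _ => ?_
          rw [mul_assoc, ← Real.exp_add]
          change prob z (run w).last m *
            Real.exp (σ * (Φ (next (run w) m) - Φ (run []) - μ * (n + 1 : ℕ))) = _
          congr 2
          push_cast
          ring
      _ ≤ Real.exp ((σ * B) ^ 2) * Real.exp (n * (σ * B) ^ 2) := by
          rw [mean_const_mul]
          exact mul_le_mul_of_nonneg_left ih (Real.exp_pos _).le
      _ = _ := by
          rw [← Real.exp_add]
          congr 1
          push_cast
          ring

lemma IsPoisson.mass_le {Φ : State → ℝ} {μ B : ℝ} (hz : IsCritical z) (h : IsPoisson z Φ μ B)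
    (hB : 1 ≤ B) {δ : ℝ} (hδ : 0 < δ) (hδ' : δ ≤ 1) {j n : ℕ} (hj : j ≤ n) :
    mass z j (fun w => δ * n ≤ Φ (run w) - Φ (run []) - μ * j) ≤
      Real.exp (-(δ ^ 2 / (4 * B ^ 2)) * n) := by
  -- the exponent `-σ δ n + n (σ B)²` is minimal at this `σ`
  set σ := δ / (2 * B ^ 2) with hσ
  have hσ0 : 0 < σ := by positivity
  have hσB : σ * B ≤ 1 := by
    rw [hσ, div_mul_eq_mul_div, div_le_one (by positivity)]
    nlinarith
  calc _ ≤ mean z j (fun w => Real.exp (-(σ * δ * n)) *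
          Real.exp (σ * (Φ (run w) - Φ (run []) - μ * j))) := by
        refine mass_le_mean hz (fun w _ => by positivity) fun w _ hw => ?_
        rw [← Real.exp_add, ← Real.exp_zero, Real.exp_le_exp]
        have := mul_le_mul_of_nonneg_left hw hσ0.le
        linarith
    _ ≤ Real.exp (-(σ * δ * n)) * Real.exp (n * (σ * B) ^ 2) := by
        rw [mean_const_mul]
        refine mul_le_mul_of_nonneg_left ((h.mean_exp_le hz hσ0.le hσB j).trans ?_)
          (Real.exp_pos _).le
        rw [Real.exp_le_exp]
        gcongr
    _ = _ := by
        rw [← Real.exp_add, hσ]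
        congr 1
        field_simp
        ring

/-- Concentration: an observable of the automaton that differs from a solution of the Poisson
equation by at most a multiple of the distance to the corner has linear growth, up to events of
exponentially small weight. -/
lemma IsPoisson.concentration {Φ f : State → ℝ} {μ G : ℝ} (hz : IsCritical z)
    (h : IsPoisson z Φ μ G) (hG : 1 ≤ G) (hf : ∀ s, |f s - Φ s| ≤ G * (s.k + 1)) {ε : ℝ}
    (hε : 0 < ε) : ∃ κ > 0, ∃ C > 0, ∀ n j : ℕ, j ≤ n →
      mass z j (fun w => ε * n < |f (run w) - μ * (j + 1)|) ≤ C * Real.exp (-κ * n) := by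
  have h2z : 0 < 2 * z := by linarith [hz.pos]
  have hlog : Real.log (2 * z) < 0 := Real.log_neg h2z (by linarith [hz.hi])
  set δ := min 1 (ε / (4 * G)) with hδ
  have hδ0 : 0 < δ := lt_min one_pos (by positivity)
  have hδ1 : δ ≤ 1 := min_le_left _ _
  have hδG : δ * G ≤ ε / 4 := by
    have : δ ≤ ε / (4 * G) := min_le_right _ _
    rw [le_div_iff₀ (by positivity)] at this
    linarith
  have hδε : δ ≤ ε / 4 := by nlinarith
  set κ := min (δ ^ 2 / (4 * G ^ 2)) (-(δ * Real.log (2 * z))) with hκ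
  have hκ0 : 0 < κ := lt_min (by positivity) (by nlinarith)
  set D := |Φ (run [])| + G + |μ| with hD
  have hD0 : 0 ≤ D := by positivity
  -- for `n ≤ n₀` the constant `exp (κ n₀)` makes the bound trivial
  set n₀ := 2 * D / ε with hn₀
  refine ⟨κ, hκ0, 102 + Real.exp (κ * n₀), by positivity, fun n j hj => ?_⟩
  rcases le_or_gt (n : ℝ) n₀ with hn | hn
  · refine (mass_le_one hz _ _).trans ?_
    calc (1 : ℝ) ≤ Real.exp (κ * n₀) * Real.exp (-κ * n) := by
          rw [← Real.exp_add, ← Real.exp_zero, Real.exp_le_exp]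
          nlinarith
      _ ≤ _ := by gcongr; linarith
  · have hn1 : D < ε / 2 * n := by
      rw [hn₀, div_lt_iff₀ hε] at hn
      linarith
    have hexp1 : Real.exp (-(δ ^ 2 / (4 * G ^ 2)) * n) ≤ Real.exp (-κ * n) := by
      rw [Real.exp_le_exp]
      exact mul_le_mul_of_nonneg_right (neg_le_neg (min_le_left _ _)) n.cast_nonneg
    have hexp2 : Real.exp (δ * n * Real.log (2 * z)) ≤ Real.exp (-κ * n) := by
      rw [Real.exp_le_exp]
      have := mul_le_mul_of_nonneg_right (min_le_right (δ ^ 2 / (4 * G ^ 2))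
        (-(δ * Real.log (2 * z)))) n.cast_nonneg
      linarith
    have hincl : ∀ w ∈ words j, ε * n < |f (run w) - μ * (j + 1)| →
        δ * n ≤ (run w).k ∨ (δ * n ≤ Φ (run w) - Φ (run []) - μ * j ∨
          δ * n ≤ -Φ (run w) - -Φ (run []) - -μ * j) := by
      intro w _ hw
      by_contra! hcon
      obtain ⟨h1, h2, h3⟩ := hcon
      have h4 : |Φ (run w) - Φ (run []) - μ * j| ≤ δ * n := abs_le.2 ⟨by linarith, by linarith⟩
      have h5 := hf (run w)
      have h6 : |f (run w) - μ * (j + 1)| ≤ |f (run w) - Φ (run w)| +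
          |Φ (run w) - Φ (run []) - μ * j| + |Φ (run [])| + |μ| := by
        have e : f (run w) - μ * (j + 1) = (f (run w) - Φ (run w)) +
          (Φ (run w) - Φ (run []) - μ * j) + Φ (run []) + -μ := by ring
        rw [e, ← abs_neg μ]
        exact (abs_add_le _ _).trans (add_le_add ((abs_add_le _ _).trans
          (add_le_add (abs_add_le _ _) le_rfl)) le_rfl)
      have hn0 : (0 : ℝ) ≤ n := n.cast_nonneg
      have h7 : G * ((run w).k + 1) ≤ ε / 4 * n + G := by nlinarith
      nlinarith
    refine (mass_le_add hz hincl).trans ?_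
    have e1 := mass_depth_le hz j (δ * n)
    have e2 : mass z j (fun w => δ * n ≤ Φ (run w) - Φ (run []) - μ * j ∨
          δ * n ≤ -Φ (run w) - -Φ (run []) - -μ * j) ≤ _ := mass_le_add hz fun w _ => id
    have e3 := h.mass_le hz hG hδ0 hδ1 hj
    have e4 := h.neg.mass_le hz hG hδ0 hδ1 hj
    have e5 : 0 ≤ Real.exp (κ * n₀) * Real.exp (-κ * n) := by positivity
    linarith

/-! ### Solutions of the Poisson equation -/

/-- The sign of the coordinate `x - y` when the walk is on the side `b`. -/
def sign (b : Bool) : ℝ := if b then -1 else 1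

/-- The asymptotic growth of `x + y` per step. -/
noncomputable def speed (z : ℝ) : ℝ := (1 - 2 * z ^ 2) / (3 - 4 * z - 2 * z ^ 2)

lemma speed_pos (hz : IsCritical z) : 0 < speed z := by
  have := hz.sq_lt
  have := hz.hi
  exact div_pos (by linarith) (by linarith)

/-- The correction that turns `x + y` into a solution of the Poisson equation. -/
noncomputable def sumCorr (z : ℝ) : Move → ℝ
  | .fwd => 0
  | .up => 1 - speed z
  | .down => 1 - (1 + 2 * z ^ 2) / (3 - 4 * z - 2 * z ^ 2)

/-- The slope in the distance to the corner of the correction of `x - y`. -/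
noncomputable def diffSlope (z : ℝ) : ℝ :=
  (1 - 2 * z) * (2 - 2 * z ^ 2) / (2 * z * (1 - 2 * z ^ 2) - (1 - 2 * z))

/-- The correction that turns `x - y` into a solution of the Poisson equation. -/
noncomputable def diffCorr (z : ℝ) : Move → ℝ
  | .fwd => diffSlope z
  | .up => 0
  | .down => (1 + diffSlope z) / (1 - 2 * z ^ 2)

lemma abs_le_sum_abs (g : Move → ℝ) (t : Move) : |g t| ≤ |g .fwd| + |g .up| + |g .down| := by
  have := abs_nonneg (g .fwd)
  have := abs_nonneg (g .up)
  have := abs_nonneg (g .down)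
  cases t <;> linarith

lemma exists_isPoisson_sum (hz : IsCritical z) : ∃ Φ : State → ℝ, ∃ G : ℝ, 1 ≤ G ∧
    IsPoisson z Φ (speed z) G ∧ ∀ s : State, |((s.p.1 : ℝ) + s.p.2) - Φ s| ≤ G * (s.k + 1) := by
  have h2 := hz.sq_lt
  have h3 := hz.hi
  have hd : 3 - 4 * z - 2 * z ^ 2 ≠ 0 := by intro h; linarith
  have hd' : 1 - 2 * z ^ 2 ≠ 0 := by intro h; linarith
  have hi : (3 - 4 * z - 2 * z ^ 2) * (3 - 4 * z - 2 * z ^ 2)⁻¹ = 1 := mul_inv_cancel₀ hd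
  set γ := 1 - speed z with hγ
  set S := |sumCorr z .fwd| + |sumCorr z .up| + |sumCorr z .down| with hS
  have hS0 : 0 ≤ S := by positivity
  let Φ : State → ℝ := fun s => s.p.1 + s.p.2 + (γ * s.k + sumCorr z s.last)
  have hinc : ∀ s m, Φ (next s m) - Φ s = match m with
      | .fwd => 1 + sumCorr z .fwd - sumCorr z s.last
      | .up => 1 - sumCorr z s.last
      | .down => -1 + γ + sumCorr z .down - sumCorr z s.last := by
    rintro ⟨p, b, t, k⟩ m
    cases m <;> cases b <;> cases k <;> simp [Φ, next, flip, sumCorr, ← hγ] <;> ring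
  refine ⟨Φ, 2 + |γ| + 2 * S + |speed z|, by linarith [abs_nonneg γ, abs_nonneg (speed z)],
    ⟨fun s => ?_, fun s m _ => ?_⟩, fun s => ?_⟩
  · simp only [hinc]
    cases s.last <;> simp [allowed, prob, sumCorr, hγ, speed, div_eq_mul_inv]
    · linear_combination -hi
    · ring
  · have hm : |Φ (next s m) - Φ s| ≤ 2 + |γ| + 2 * S := by
      have h4 := abs_le.1 (abs_le_sum_abs (sumCorr z) s.last)
      have h5 := abs_le.1 (abs_le_sum_abs (sumCorr z) .fwd)
      have h6 := abs_le.1 (abs_le_sum_abs (sumCorr z) .down)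
      have h7 := neg_abs_le γ
      have h8 := le_abs_self γ
      rw [hinc, abs_le]
      cases m <;> constructor <;> simp only <;> linarith [h4.1, h4.2, h5.1, h5.2, h6.1, h6.2]
    exact (abs_sub _ _).trans (by linarith)
  · have h4 := abs_le_sum_abs (sumCorr z) s.last
    have e : ((s.p.1 : ℝ) + s.p.2) - Φ s = -(γ * s.k + sumCorr z s.last) := by simp [Φ]
    rw [e, abs_neg]
    refine (abs_add_le _ _).trans ?_
    rw [abs_mul, Nat.abs_cast]
    have hk : (0 : ℝ) ≤ s.k := s.k.cast_nonneg
    nlinarith [abs_nonneg γ, abs_nonneg (speed z)]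

lemma exists_isPoisson_diff (hz : IsCritical z) : ∃ Φ : State → ℝ, ∃ G : ℝ, 1 ≤ G ∧
    IsPoisson z Φ 0 G ∧ ∀ s : State, |((s.p.1 : ℝ) - s.p.2) - Φ s| ≤ G * (s.k + 1) := by
  have h2 := hz.sq_lt
  have h3 := hz.hi
  have h3' := hz.lo
  have hd : 2 * z * (1 - 2 * z ^ 2) - (1 - 2 * z) ≠ 0 := by intro h; nlinarith
  have hd' : 1 - 2 * z ^ 2 ≠ 0 := by intro h; linarith
  have hi : (1 - 2 * z ^ 2) * (1 - 2 * z ^ 2)⁻¹ = 1 := mul_inv_cancel₀ hd'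
  set γ := diffSlope z with hγ
  set S := |diffCorr z .fwd| + |diffCorr z .up| + |diffCorr z .down| with hS
  have hS0 : 0 ≤ S := by positivity
  let Φ : State → ℝ := fun s => s.p.1 - s.p.2 + sign s.top * (γ * s.k + diffCorr z s.last)
  have hinc : ∀ s m, Φ (next s m) - Φ s = sign s.top * match m with
      | .fwd => 1 + γ - diffCorr z s.last
      | .up => -1 - γ - diffCorr z s.last
      | .down => 1 + γ + diffCorr z .down - diffCorr z s.last := by
    rintro ⟨p, b, t, k⟩ m
    cases m <;> cases b <;> cases k <;> simp [Φ, next, flip, sign, diffCorr, ← hγ] <;> ring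
  have hsign : ∀ b, |sign b| = 1 := fun b => by cases b <;> simp [sign]
  refine ⟨Φ, 2 + |γ| + 2 * S, by linarith [abs_nonneg γ],
    ⟨fun s => ?_, fun s m _ => ?_⟩, fun s => ?_⟩
  · have e : γ * (2 * z * (1 - 2 * z ^ 2) - (1 - 2 * z)) = (1 - 2 * z) * (2 - 2 * z ^ 2) := by
      rw [hγ, diffSlope, div_mul_cancel₀ _ hd]
    simp only [hinc, sub_zero]
    cases s.last <;> simp [allowed, prob, diffCorr, ← hγ, div_eq_mul_inv]
    · refine mul_right_cancel₀ hd' ?_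
      linear_combination (-sign s.top) * e + sign s.top * (1 - 2 * z) * (1 + γ) * hi
    · ring
    · linear_combination -sign s.top * (1 + γ) * hi
  · have h4 := abs_le.1 (abs_le_sum_abs (diffCorr z) s.last)
    have h6 := abs_le.1 (abs_le_sum_abs (diffCorr z) .down)
    have h7 := neg_abs_le γ
    have h8 := le_abs_self γ
    rw [sub_zero, hinc, abs_mul, hsign, one_mul, abs_le]
    cases m <;> constructor <;> simp only <;> linarith [h4.1, h4.2, h6.1, h6.2]
  · have h4 := abs_le_sum_abs (diffCorr z) s.last
    have e : ((s.p.1 : ℝ) - s.p.2) - Φ s = -(sign s.top * (γ * s.k + diffCorr z s.last)) := by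
      simp [Φ]
    rw [e, abs_neg, abs_mul, hsign, one_mul]
    refine (abs_add_le _ _).trans ?_
    rw [abs_mul, Nat.abs_cast]
    have hk : (0 : ℝ) ≤ s.k := s.k.cast_nonneg
    nlinarith [abs_nonneg γ]

/-! ### Counting words -/

/-- At each time up to `n`, the walk is within `ε n` of the line of slope one and speed
`speed z / 2` in each coordinate, up to exponentially small weight. Time is shifted by the initial
east step. -/
lemma exists_deviation_bound (hz : IsCritical z) {ε : ℝ} (hε : 0 < ε) :
    ∃ κ > 0, ∃ C > 0, ∀ n j : ℕ, j ≤ n →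
      mass z j (fun w => ¬ (|((run w).p.1 : ℝ) - speed z / 2 * (j + 1)| ≤ ε * n ∧
        |((run w).p.2 : ℝ) - speed z / 2 * (j + 1)| ≤ ε * n)) ≤ C * Real.exp (-κ * n) := by
  obtain ⟨Φ, G, hG, hΦ, hf⟩ := exists_isPoisson_sum hz
  obtain ⟨Φ', G', hG', hΦ', hf'⟩ := exists_isPoisson_diff hz
  obtain ⟨κ, hκ, C, hC, h⟩ := hΦ.concentration hz hG hf hε
  obtain ⟨κ', hκ', C', hC', h'⟩ := hΦ'.concentration hz hG' hf' hε
  refine ⟨min κ κ', lt_min hκ hκ', C + C', add_pos hC hC', fun n j hj => ?_⟩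
  have hn : (0 : ℝ) ≤ n := n.cast_nonneg
  have h1 : C * Real.exp (-κ * n) ≤ C * Real.exp (-min κ κ' * n) := by
    gcongr
    exact min_le_left _ _
  have h2 : C' * Real.exp (-κ' * n) ≤ C' * Real.exp (-min κ κ' * n) := by
    gcongr
    exact min_le_right _ _
  have h3 := mass_le_add hz (n := j)
    (P := fun w => ¬ (|((run w).p.1 : ℝ) - speed z / 2 * (j + 1)| ≤ ε * n ∧
        |((run w).p.2 : ℝ) - speed z / 2 * (j + 1)| ≤ ε * n))
    (Q := fun w => ε * n < |((run w).p.1 + (run w).p.2 : ℝ) - speed z * (j + 1)|)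
    (R := fun w => ε * n < |((run w).p.1 - (run w).p.2 : ℝ) - 0 * (j + 1)|) fun w _ hw => by
      by_contra! hcon
      obtain ⟨ha, hb⟩ := hcon
      rw [abs_le] at ha hb
      exact hw ⟨abs_le.2 ⟨by linarith, by linarith⟩, abs_le.2 ⟨by linarith, by linarith⟩⟩
  linarith [h n j hj, h' n j hj]

/-- The words of length `n` whose path ends at the corner of its box. -/
def cornerWords (n : ℕ) : Finset (List Move) := {w ∈ words n | (run w).k = 0}

/-- Union bound: a word of length `n` that ends at a corner has weight at least `z ^ n / 2`. -/
lemma card_bad_le (hz : IsCritical z) (n : ℕ) (P : List Move → Prop) [DecidablePred P]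
    (Q : ℕ → List Move → Prop) (hPQ : ∀ w, P w → ∃ j ≤ n, Q j (w.drop (n - j))) :
    (({w ∈ cornerWords n | P w} : Finset _).card : ℝ) * (z ^ n / 2) ≤
      ∑ j ∈ Finset.range (n + 1), mass z j (Q j) := by
  have hzn := pow_nonneg hz.pos.le n
  have hpt : ∀ w ∈ words n, 0 ≤ z ^ n * weight z (run w) *
      ∑ j ∈ Finset.range (n + 1), Set.indicator {w | Q j w} (1 : List Move → ℝ) (w.drop (n - j)) :=
    fun w _ => mul_nonneg (mul_nonneg hzn (hz.weight_pos _).le)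
      (Finset.sum_nonneg fun j _ => indicator_nonneg _ _)
  calc _ = ∑ w ∈ (cornerWords n).filter P, z ^ n / 2 := by
        rw [Finset.sum_const, nsmul_eq_mul]
    _ ≤ ∑ w ∈ (cornerWords n).filter P,
          z ^ n * weight z (run w) * ∑ j ∈ Finset.range (n + 1),
            Set.indicator {w | Q j w} (1 : List Move → ℝ) (w.drop (n - j)) := by
        refine Finset.sum_le_sum fun w hw => ?_
        simp only [cornerWords, Finset.mem_filter] at hw
        obtain ⟨⟨_, hk⟩, hP⟩ := hw
        obtain ⟨j, hj, hQ⟩ := hPQ w hP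
        have h1 : 1 / 2 ≤ weight z (run w) := by
          rw [weight, hk, pow_zero, one_mul]
          exact hz.half_le_coeff _
        have h2 : (1 : ℝ) ≤ ∑ j ∈ Finset.range (n + 1),
            Set.indicator {w | Q j w} (1 : List Move → ℝ) (w.drop (n - j)) := by
          refine le_trans ?_ (Finset.single_le_sum (fun i _ => indicator_nonneg (Q i) _)
            (Finset.mem_range.2 (Nat.lt_succ_of_le hj)))
          simp [hQ]
        calc z ^ n / 2 = z ^ n * (1 / 2) * 1 := by ring
          _ ≤ _ := by gcongr
    _ ≤ ∑ w ∈ words n, z ^ n * weight z (run w) * ∑ j ∈ Finset.range (n + 1),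
            Set.indicator {w | Q j w} (1 : List Move → ℝ) (w.drop (n - j)) := by
        refine Finset.sum_le_sum_of_subset_of_nonneg (fun w hw => ?_) fun w hw _ => hpt w hw
        simp only [cornerWords, Finset.mem_filter] at hw
        exact hw.1.1
    _ = _ := by
        simp only [Finset.mul_sum]
        rw [Finset.sum_comm]
        refine Finset.sum_congr rfl fun j hj => ?_
        obtain ⟨i, rfl⟩ := Nat.exists_eq_add_of_le (Nat.le_of_lt_succ (Finset.mem_range.1 hj))
        simp only [Nat.add_sub_cancel_left]
        exact mean_drop hz j i (Set.indicator {w | Q j w} 1)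

lemma fwd_cons_mem {n : ℕ} {w : List Move} (hw : w ∈ words n) : .fwd :: w ∈ words (n + 1) :=
  mem_words_succ.2 ⟨w, hw, _, fwd_mem_allowed _, rfl⟩

lemma up_append {n : ℕ} {w : List Move} (hw : w ∈ words n) (ht : (run w).last ≠ .down) {j : ℕ}
    (hj : j ≤ (run w).k) : List.replicate j .up ++ w ∈ words (n + j) ∧
      (run (List.replicate j .up ++ w)).last ≠ .down ∧
      (run (List.replicate j .up ++ w)).k = (run w).k - j := by
  induction j with
  | zero => exact ⟨hw, ht, rfl⟩
  | succ j ih =>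
    obtain ⟨h1, h2, h3⟩ := ih (by omega)
    have h4 : (run (List.replicate j .up ++ w)).k ≠ 0 := by omega
    rw [List.replicate_succ, List.cons_append]
    refine ⟨mem_words_succ.2 ⟨_, h1, _, mem_allowed_up.2 h2, rfl⟩, ?_, ?_⟩
    · simp [run, next, h4]
    · simp only [run, next, if_neg h4]
      omega

lemma fwd_append {n : ℕ} {w : List Move} (hw : w ∈ words n) (j : ℕ) :
    List.replicate j .fwd ++ w ∈ words (n + j) ∧
      (run (List.replicate j .fwd ++ w)).k = (run w).k := by
  induction j with
  | zero => exact ⟨hw, rfl⟩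
  | succ j ih =>
    rw [List.replicate_succ, List.cons_append]
    exact ⟨fwd_cons_mem ih.1, ih.2⟩

/-- A walk at distance at most `K` from the corner can be brought to a corner in exactly `K + 1`
further steps: a step forward, up to the corner, then straight on. -/
lemma card_le_card_cornerWords (m K : ℕ) :
    ({w ∈ words m | (run w).k ≤ K} : Finset _).card ≤ (cornerWords (m + 1 + K)).card := by
  refine Finset.card_le_card_of_injOn (fun w => List.replicate (K - (run w).k) .fwd ++
    (List.replicate (run w).k .up ++ (.fwd :: w))) (fun w hw => ?_) ?_
  · simp only [Finset.coe_filter, Set.mem_ofPred_eq] at hw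
    obtain ⟨h1, -, h2⟩ := up_append (fwd_cons_mem hw.1) (j := (run w).k) (by simp [run, next])
      (by simp [run, next])
    obtain ⟨h3, h4⟩ := fwd_append h1 (K - (run w).k)
    rw [add_assoc, Nat.add_sub_cancel' hw.2] at h3
    simp only [cornerWords, Finset.coe_filter, Set.mem_ofPred_eq]
    refine ⟨h3, ?_⟩
    rw [h4, h2]
    simp [run, next]
  · intro w hw w' hw' h
    simp only [Finset.coe_filter, Set.mem_ofPred_eq] at hw hw'
    have key : ∀ v : List Move, (run v).k ≤ K → (List.replicate (K - (run v).k) Move.fwd ++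
        (List.replicate (run v).k Move.up ++ (Move.fwd :: v))).drop (K + 1) = v := fun v hv => by
      rw [List.append_cons, ← List.append_assoc]
      refine List.drop_left' ?_
      simp
      omega
    have := congrArg (List.drop (K + 1)) h
    simpa only [key w hw.2, key w' hw'.2] using this

/-- The number of 2-sided prudent paths is at least of order `z ^ (-n)`: the walk is within a fixed
distance of the corner with probability at least `1 / 2`. -/
lemma exists_le_card_cornerWords (hz : IsCritical z) :
    ∃ η > 0, ∃ N : ℕ, ∀ n ≥ N, η ≤ z ^ n * (cornerWords n).card := by
  have h2z : 0 < 2 * z := by linarith [hz.pos]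
  obtain ⟨K, hK⟩ := exists_pow_lt_of_lt_one (show (0 : ℝ) < 1 / 200 by norm_num)
    (show 2 * z < 1 by linarith [hz.hi])
  refine ⟨z ^ (1 + K) / 2, by have := hz.pos; positivity, 1 + K, fun n hn => ?_⟩
  obtain ⟨m, rfl⟩ := Nat.exists_eq_add_of_le' hn
  have hzm := pow_nonneg hz.pos.le m
  have h1 : mass z m (fun w => (K : ℝ) ≤ (run w).k) ≤ 1 / 2 := by
    refine (mass_depth_le hz m K).trans ?_
    rw [mul_comm (K : ℝ), Real.exp_mul, Real.exp_log h2z, Real.rpow_natCast]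
    linarith
  have h2 : mass z m (fun w => (run w).k ≤ K) ≤
      z ^ m * ({w ∈ words m | (run w).k ≤ K} : Finset _).card := by
    calc _ ≤ ∑ w ∈ words m, if (run w).k ≤ K then z ^ m else 0 := by
          refine Finset.sum_le_sum fun w _ => ?_
          by_cases h : (run w).k ≤ K
          · simpa [h] using mul_le_of_le_one_right hzm (hz.weight_le_one (run w))
          · simp [h]
      _ = _ := by
          rw [← Finset.sum_filter, Finset.sum_const, nsmul_eq_mul, mul_comm]
  have h3 : (1 : ℝ) ≤ mass z m (fun w => (K : ℝ) ≤ (run w).k) +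
      mass z m (fun w => (run w).k ≤ K) := by
    have := mass_le_add hz (n := m) (P := fun _ => True) (Q := fun w => (K : ℝ) ≤ (run w).k)
      (R := fun w => (run w).k ≤ K) fun w _ _ => by
        rw [Nat.cast_le]
        exact le_total _ _
    refine le_trans (le_of_eq ?_) this
    rw [mass, ← mean_one hz m]
    simp
  have h4 : (({w ∈ words m | (run w).k ≤ K} : Finset _).card : ℝ) ≤
      (cornerWords (m + (1 + K))).card := by
    rw [← add_assoc]
    exact_mod_cast card_le_card_cornerWords m K
  have h5 : 1 / 2 ≤ z ^ m * (cornerWords (m + (1 + K))).card :=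
    le_trans (by linarith) (mul_le_mul_of_nonneg_left h4 hzm)
  have h6 := mul_le_mul_of_nonneg_left h5 (pow_nonneg hz.pos.le (1 + K))
  rw [pow_add z m]
  linarith

/-! ### From words to the uniform law -/

/-- The uniform law on the 2-sided prudent paths is the image of the uniform law on the words that
end at a corner, so an event that holds for all words without `Q` has at least the probability of
`¬ Q`. -/
lemma le_unifTwoSided (n : ℕ) (A : Set (Fin (n + 1 + 1) → ℤ × ℤ)) (Q : List Move → Prop)
    [DecidablePred Q] (hne : (cornerWords n).Nonempty)
    (h : ∀ w ∈ cornerWords n, (fun i : Fin (n + 1 + 1) => path w i) ∉ A → Q w) :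
    1 - (({w ∈ cornerWords n | Q w} : Finset _).card : ℝ) / (cornerWords n).card ≤
      (unifTwoSided (n + 1)).real A := by
  classical
  let ψ : List Move → Fin (n + 1 + 1) → ℤ × ℤ := fun w i => path w i
  set F := (cornerWords n).image ψ with hF
  have hΩ : twoSidedPaths (n + 1) = F := by
    ext π
    simp only [hF, Finset.coe_image, Set.mem_image, Finset.mem_coe, cornerWords,
      Finset.mem_filter]
    constructor
    · intro hπ
      obtain ⟨w, hw, hk, e⟩ := exists_word hπ
      exact ⟨w, ⟨hw, hk⟩, e⟩
    · rintro ⟨w, ⟨hw, hk⟩, rfl⟩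
      exact path_mem_twoSidedPaths hw hk
  have hcard : F.card = (cornerWords n).card := by
    refine Finset.card_image_of_injOn fun w hw w' hw' e => ?_
    simp only [cornerWords, Finset.coe_filter, Set.mem_ofPred_eq] at hw hw'
    exact word_unique hw.1 hw'.1 fun i hi => congrFun e ⟨i, by omega⟩
  have hpos : (0 : ℝ) < (cornerWords n).card := by exact_mod_cast hne.card_pos
  have hbad : (F.filter (· ∉ A)).card ≤ ({w ∈ cornerWords n | Q w} : Finset _).card := by
    refine (Finset.card_le_card (t := ({w ∈ cornerWords n | Q w} : Finset _).image ψ) ?_).trans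
      Finset.card_image_le
    intro π hπ
    obtain ⟨h1, h2⟩ := Finset.mem_filter.1 hπ
    obtain ⟨w, hw, rfl⟩ := Finset.mem_image.1 h1
    exact Finset.mem_image_of_mem _ (Finset.mem_filter.2 ⟨hw, h w hw h2⟩)
  have hsplit := Finset.card_filter_add_card_filter_not (s := F) (· ∈ A)
  have hreal : (unifTwoSided (n + 1)).real A = ((F.filter (· ∈ A)).card : ℝ) / F.card := by
    have e : (F : Set (Fin (n + 1 + 1) → ℤ × ℤ)) ∩ A = (F.filter (· ∈ A) : Finset _) := by
      ext π
      simp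
    rw [unifTwoSided, hΩ, ProbabilityTheory.uniformOn, MeasureTheory.measureReal_def,
      ProbabilityTheory.cond_apply F.finite_toSet.measurableSet, e,
      MeasureTheory.Measure.count_apply_finset, MeasureTheory.Measure.count_apply_finset]
    simp [div_eq_inv_mul]
  rw [hreal, hcard, sub_le_iff_le_add, ← add_div, le_div_iff₀ hpos, one_mul]
  have h1 : F.card ≤ (F.filter (· ∈ A)).card + ({w ∈ cornerWords n | Q w} : Finset _).card := by
    omega
  rw [hcard] at h1
  exact_mod_cast h1

lemma norm_vec_le (a b : ℝ) : ‖(!₂[a, b] : EuclideanSpace ℝ (Fin 2))‖ ≤ |a| + |b| := by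
  rw [EuclideanSpace.norm_eq, Real.sqrt_le_left (by positivity)]
  simp only [Fin.sum_univ_two, Real.norm_eq_abs]
  simp
  nlinarith [sq_abs a, sq_abs b, mul_nonneg (abs_nonneg a) (abs_nonneg b)]

/-- The interpolated path is close to the line at all times if it is at the lattice times. -/
lemma norm_rescaled_sub_le {L : ℕ} (hL : 0 < L) {π : Fin (L + 1) → ℤ × ℤ} {c ε : ℝ}
    (h : ∀ i : Fin (L + 1), |((π i).1 : ℝ) - c * (i : ℕ)| ≤ ε / 2 * L ∧
      |((π i).2 : ℝ) - c * (i : ℕ)| ≤ ε / 2 * L) {t : ℝ} (ht : t ∈ Set.Icc (0 : ℝ) 1) :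
    ‖rescaled π t - (c * t) • (!₂[1, 1] : EuclideanSpace ℝ (Fin 2))‖ ≤ ε := by
  have hL' : (0 : ℝ) < L := by exact_mod_cast hL
  have hpos : ∀ m ≤ L, ‖pos π m - (c * m) • (!₂[1, 1] : EuclideanSpace ℝ (Fin 2))‖ ≤ ε * L := by
    intro m hm
    obtain ⟨h1, h2⟩ := h ⟨min m L, Nat.lt_succ_of_le (min_le_right m L)⟩
    simp only [min_eq_left hm] at h1 h2
    have e : pos π m - (c * m) • (!₂[1, 1] : EuclideanSpace ℝ (Fin 2)) =
        !₂[((π ⟨min m L, Nat.lt_succ_of_le (min_le_right m L)⟩).1 : ℝ) - c * m,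
          ((π ⟨min m L, Nat.lt_succ_of_le (min_le_right m L)⟩).2 : ℝ) - c * m] := by
      ext i
      fin_cases i <;> simp [pos]
    rw [e]
    simp only [min_eq_left hm]
    exact (norm_vec_le _ _).trans (by linarith)
  set m := ⌊t * L⌋₊ with hm
  set θ := t * L - m with hθ
  have htL : 0 ≤ t * L := mul_nonneg ht.1 hL'.le
  have hθ0 : 0 ≤ θ := sub_nonneg.2 (Nat.floor_le htL)
  have hθ1 : θ ≤ 1 := by linarith [Nat.lt_floor_add_one (t * L)]
  have htL' : t * L ≤ L := mul_le_of_le_one_left hL'.le ht.2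
  have hmL : m ≤ L := Nat.floor_le_of_le htL'
  have h1 := hpos m hmL
  have h2 : ‖θ • (pos π (m + 1) - (c * (m + 1 : ℕ)) • (!₂[1, 1] : EuclideanSpace ℝ (Fin 2)))‖ ≤
      θ * (ε * L) := by
    rw [norm_smul, Real.norm_of_nonneg hθ0]
    rcases hmL.lt_or_eq with hlt | heq
    · exact mul_le_mul_of_nonneg_left (hpos _ hlt) hθ0
    · -- `m = L` only at `t = 1`, where the interpolation coefficient vanishes
      have : θ = 0 := le_antisymm (by rw [hθ, heq]; linarith) hθ0
      simp [this]
  have e : rescaled π t - (c * t) • (!₂[1, 1] : EuclideanSpace ℝ (Fin 2)) =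
      (L : ℝ)⁻¹ • ((1 - θ) • (pos π m - (c * m) • (!₂[1, 1] : EuclideanSpace ℝ (Fin 2))) +
        θ • (pos π (m + 1) - (c * (m + 1 : ℕ)) • (!₂[1, 1] : EuclideanSpace ℝ (Fin 2)))) := by
    have ht' : c * t = (L : ℝ)⁻¹ * (c * (m + θ)) := by
      rw [hθ]
      field_simp
      ring
    rw [ht', rescaled, ← hm, ← hθ]
    push_cast
    module
  rw [e, norm_smul, norm_inv, Real.norm_of_nonneg hL'.le, inv_mul_le_iff₀ hL']
  refine (norm_add_le _ _).trans ?_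
  rw [norm_smul, Real.norm_of_nonneg (sub_nonneg.2 hθ1)]
  have h3 := mul_le_mul_of_nonneg_left h1 (sub_nonneg.2 hθ1)
  linarith

lemma near_line_of_word {n : ℕ} {w : List Move} (hw : w ∈ words n) {c ε : ℝ} (hε : 0 ≤ ε)
    (h : ∀ j ≤ n, |((run (w.drop (n - j))).p.1 : ℝ) - c * (j + 1)| ≤ ε / 2 * n ∧
      |((run (w.drop (n - j))).p.2 : ℝ) - c * (j + 1)| ≤ ε / 2 * n) {t : ℝ}
    (ht : t ∈ Set.Icc (0 : ℝ) 1) :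
    ‖rescaled (fun i : Fin (n + 1 + 1) => path w i) t -
      (c * t) • (!₂[1, 1] : EuclideanSpace ℝ (Fin 2))‖ ≤ ε := by
  refine norm_rescaled_sub_le n.succ_pos (fun i => ?_) ht
  obtain ⟨i, hi⟩ := i
  cases i with
  | zero => simp [path_zero]; positivity
  | succ j =>
    have hl := length_of_mem_words hw
    obtain ⟨h1, h2⟩ := h j (by omega)
    have e := path_succ w (j := j) (by omega)
    rw [hl] at e
    simp only [e]
    push_cast
    exact ⟨h1.trans (by linarith), h2.trans (by linarith)⟩

end PrudentWalk

theorem theorem3 :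
    ∃ c : ℝ, 0 < c ∧ ∀ ε : ℝ, 0 < ε →
      Filter.Tendsto
        (fun L : ℕ => (PrudentWalk.unifTwoSided L).real
          {π | ∀ t ∈ Set.Icc (0 : ℝ) 1,
            ‖PrudentWalk.rescaled π t - (c * t) • (!₂[1, 1] : EuclideanSpace ℝ (Fin 2))‖ ≤ ε})
        Filter.atTop (nhds 1) := by
  classical
  obtain ⟨z, hz⟩ := PrudentWalk.exists_isCritical
  refine ⟨PrudentWalk.speed z / 2, half_pos (PrudentWalk.speed_pos hz), fun ε hε => ?_⟩
  obtain ⟨κ, hκ, C, hC, hdev⟩ := PrudentWalk.exists_deviation_bound hz (half_pos hε)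
  obtain ⟨η, hη, N, hN⟩ := PrudentWalk.exists_le_card_cornerWords hz
  rw [← Filter.tendsto_add_atTop_iff_nat 1]
  have hlim : Filter.Tendsto
      (fun n : ℕ => 1 - 2 * C / η * ((n + 1) * Real.exp (-κ * n))) Filter.atTop (nhds 1) := by
    have hr : |Real.exp (-κ)| < 1 := by
      rw [abs_of_pos (Real.exp_pos _), Real.exp_lt_one_iff]
      linarith
    have h1 := (tendsto_self_mul_const_pow_of_abs_lt_one hr).add
      (tendsto_pow_atTop_nhds_zero_of_abs_lt_one hr)
    have h2 := (h1.const_mul (2 * C / η)).const_sub 1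
    simp only [add_zero, mul_zero, sub_zero] at h2
    refine h2.congr fun n => ?_
    rw [← Real.exp_nat_mul, mul_comm (n : ℝ) (-κ)]
    ring
  refine tendsto_of_tendsto_of_tendsto_of_le_of_le' hlim tendsto_const_nhds ?_
    (Filter.Eventually.of_forall fun n => ?_)
  · filter_upwards [Filter.eventually_ge_atTop N] with n hn
    have hcard := hN n hn
    have hzn := pow_pos hz.pos n
    have hpos : (0 : ℝ) < (PrudentWalk.cornerWords n).card := by
      by_contra! hcon
      nlinarith
    let Q : ℕ → List PrudentWalk.Move → Prop := fun j u =>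
      ¬ (|((PrudentWalk.run u).p.1 : ℝ) - PrudentWalk.speed z / 2 * (j + 1)| ≤ ε / 2 * n ∧
        |((PrudentWalk.run u).p.2 : ℝ) - PrudentWalk.speed z / 2 * (j + 1)| ≤ ε / 2 * n)
    let P : List PrudentWalk.Move → Prop := fun w => ∃ j ≤ n, Q j (w.drop (n - j))
    refine le_trans ?_ (PrudentWalk.le_unifTwoSided n _ P (Finset.card_pos.1 (by exact_mod_cast hpos))
      fun w hw hA => ?_)
    · have hbad := PrudentWalk.card_bad_le hz n P Q fun _ => id
      have hsum : ∑ j ∈ Finset.range (n + 1), PrudentWalk.mass z j (Q j) ≤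
          (n + 1) * (C * Real.exp (-κ * n)) := by
        refine (Finset.sum_le_card_nsmul _ _ _ fun j hj =>
          hdev n j (Nat.le_of_lt_succ (Finset.mem_range.1 hj))).trans (le_of_eq ?_)
        simp
      refine sub_le_sub_left ?_ 1
      rw [div_le_iff₀ hpos]
      set X := (n + 1) * Real.exp (-κ * n) with hX
      have hX0 : 0 ≤ X := by positivity
      refine le_of_mul_le_mul_right ?_ (half_pos hzn)
      calc _ ≤ _ := hbad.trans hsum
        _ = C * X / η * η := by rw [hX]; field_simp
        _ ≤ C * X / η * (z ^ n * (PrudentWalk.cornerWords n).card) := by gcongr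
        _ = _ := by ring
    · by_contra hcon
      refine hA fun t ht => PrudentWalk.near_line_of_word (Finset.mem_filter.1 hw).1 hε.le
        (fun j hj => not_not.1 fun h => hcon ⟨j, hj, h⟩) ht
  · rw [PrudentWalk.unifTwoSided]
    exact MeasureTheory.measureReal_le_one
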